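/- Let $d\ge r\ge 1$, let $U\in\mathbb R^{d\times r}$ have orthonormal columns, let $U_\perp\in\mathbb R^{d\times(d-r)}$ be an orthonormal complement of $U$ (that is, $[U\ U_\perp]$ is orthogonal), and let $\Lambda\in\mathbb R^{d\times d}$ be symmetric positive definite, with blocks $\Lambda_{11}=U^\top\Lambda U$, $\Lambda_{12}=U^\top\Lambda U_\perp$, $\Lambda_{22}=U_\perp^\top\Lambda U_\perp$. Draw independently $\beta\sim\mathcal N(0,I_r)$, demonstration inputs $x_1,\dots,x_M\sim\mathcal N(0,\Lambda)$ and a query $x\sim\mathcal N(0,\Lambda)$; set $w=U\beta$ and $y_i=\langle w,x_i\rangle$. For $\lambda=\lambda_0/M$ with fixed $\lambda_0>0$, let $$\hat w_{\mathcal D}=(S+\lambda I_d)^{-1}\Big(\tfrac1M\sum_{i=1}^M x_iy_i\Big),\qquad S=\tfrac1M\sum_{i=1}^M x_ix_i^\top,\qquad f_{\mathcal D}(x)=\langle\hat w_{\mathcal D},x\rangle$$ be the ambient ridge predictor. For $a_0\ge 1$ and $\delta\in(0,1)$ put $L_\delta=r+\log(a_0/\delta)$ and $R_\perp(\delta)=\sqrt{\operatorname{tr}\Lambda_{22}}+\sqrt{\|\Lambda_{22}\|_{\mathrm{op}}\log(a_0/\delta)}$.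 **Corollary (Nuisance stability).** There is a universal numerical constant $a_0\ge1$ and there are constants $K_0,K_{\mathrm{stab}}>0$, depending only on $\Lambda_{11}$ and $\lambda_0$, such that if $\Lambda_{12}=0$ and $M\ge K_0L_\delta$, then with probability at least $1-\delta$ over $\beta$, the demonstrations and the query, simultaneously for every $v\in\operatorname{span}(U)^\perp$, $$|f_{\mathcal D}(x+v)-f_{\mathcal D}(x)|\le K_{\mathrm{stab}}\,R_\perp(\delta)\,\|v\|\,\sqrt{\frac{r+\log(a_0/\delta)}{M}}.$$ Moreover, for every $\sigma>0$ and all data $x_1,\dots,x_M\in\mathbb R^d$, $y\in\mathbb R^M$, let $Z$ be the $M\times r$ matrix with rows $(U^\top x_i)^\top$ and let $\mu_{\mathcal D}=\big(I_r+\sigma^{-2}Z^\top Z\big)^{-1}\sigma^{-2}Z^\top y$ be the posterior mean of $\beta$ in the model $y=Z\beta+\varepsilon$, $\beta\sim\mathcal N(0,I_r)$, $\varepsilon\sim\mathcal N(0,\sigma^2I_M)$. The Bayes concept predictor $x\mapsto\mu_{\mathcal D}^\top U^\top x$ satisfies $\mu_{\mathcal D}^\top U^\top(x+v)=\mu_{\mathcal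 D}^\top U^\top x$ for all $x\in\mathbb R^d$ and $v\in\operatorname{span}(U)^\perp$. -/

import Mathlib

open MeasureTheory ProbabilityTheory
open scoped Matrix

namespace ConceptICL

/-- The linear span of the columns of `U`, as a subspace of Euclidean space. -/
def colSpan {d r : ℕ} (U : Matrix (Fin d) (Fin r) ℝ) : Submodule ℝ (EuclideanSpace ℝ (Fin d)) :=
  Submodule.span ℝ (Set.range fun j : Fin r => WithLp.toLp 2 (fun i : Fin d => U i j))

/-- The task parameter `w = U β`. -/
noncomputable def taskParam {d r : ℕ} (U : Matrix (Fin d) (Fin r) ℝ)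
    (β : EuclideanSpace ℝ (Fin r)) : EuclideanSpace ℝ (Fin d) :=
  WithLp.toLp 2 (U *ᵥ β.ofLp)

/-- The concept coordinates `z = Uᵀ x`. -/
noncomputable def conceptCoord {d r : ℕ} (U : Matrix (Fin d) (Fin r) ℝ)
    (x : EuclideanSpace ℝ (Fin d)) : EuclideanSpace ℝ (Fin r) :=
  WithLp.toLp 2 (Uᵀ *ᵥ x.ofLp)

/-- The noiseless labels `y i = ⟨w, x i⟩`. -/
noncomputable def labels {d M : ℕ} (w : EuclideanSpace ℝ (Fin d))
    (X : Fin M → EuclideanSpace ℝ (Fin d)) : Fin M → ℝ :=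
  fun i => inner ℝ w (X i)

/-- The empirical second-moment matrix `S = (1/M) ∑ i, x i (x i)ᵀ`. -/
noncomputable def empCov {d M : ℕ} (X : Fin M → EuclideanSpace ℝ (Fin d)) :
    Matrix (Fin d) (Fin d) ℝ :=
  (1 / (M : ℝ)) • ∑ i, Matrix.vecMulVec (X i).ofLp (X i).ofLp

/-- The ambient ridge estimator `ŵ = (S + l I)⁻¹ ((1/M) ∑ i, y i x i)` with ridge parameter `l`. -/
noncomputable def ridgeEst {d M : ℕ} (l : ℝ) (X : Fin M → EuclideanSpace ℝ (Fin d))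
    (y : Fin M → ℝ) : EuclideanSpace ℝ (Fin d) :=
  WithLp.toLp 2 ((empCov X + l • (1 : Matrix (Fin d) (Fin d) ℝ))⁻¹ *ᵥ
    ((1 / (M : ℝ)) • ∑ i, y i • (X i).ofLp))

/-- The ambient ridge predictor `f x = ⟨ŵ, x⟩`. -/
noncomputable def ridgePred {d M : ℕ} (l : ℝ) (X : Fin M → EuclideanSpace ℝ (Fin d))
    (y : Fin M → ℝ) (x : EuclideanSpace ℝ (Fin d)) : ℝ :=
  inner ℝ (ridgeEst l X y) x

/-- The joint law of the task coefficient `β ∼ N(0, I)`, the demonstration inputs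
`x 1, …, x M ∼ N(0, Λ)` and the query `x ∼ N(0, Λ)`, all independent. -/
noncomputable def dataLaw {d : ℕ} (r M : ℕ) (Λ : Matrix (Fin d) (Fin d) ℝ) :
    Measure (EuclideanSpace ℝ (Fin r) ×
      (Fin M → EuclideanSpace ℝ (Fin d)) × EuclideanSpace ℝ (Fin d)) :=
  (stdGaussian (EuclideanSpace ℝ (Fin r))).prod
    ((Measure.pi fun _ : Fin M => multivariateGaussian 0 Λ).prod (multivariateGaussian 0 Λ))

/-- `L = r + log (a / δ)`. -/
noncomputable def logDim (a : ℝ) (r : ℕ) (δ : ℝ) : ℝ := (r : ℝ) + Real.log (a / δ)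

/-- The nuisance radius `√(tr Λ₂₂) + √(‖Λ₂₂‖ log (a / δ))`, with the `ℓ²` operator norm. -/
noncomputable def nuisanceRadius {k : ℕ} (a : ℝ) (Λ22 : Matrix (Fin k) (Fin k) ℝ) (δ : ℝ) : ℝ :=
  Real.sqrt Λ22.trace +
    Real.sqrt (‖Matrix.toEuclideanCLM (n := Fin k) (𝕜 := ℝ) Λ22‖ * Real.log (a / δ))

/-- The `M × r` matrix `Z` whose rows are the concept coordinates of the demonstration inputs. -/
noncomputable def conceptDesign {d r M : ℕ} (U : Matrix (Fin d) (Fin r) ℝ)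
    (X : Fin M → EuclideanSpace ℝ (Fin d)) : Matrix (Fin M) (Fin r) ℝ :=
  Matrix.of fun i => (conceptCoord U (X i)).ofLp

/-- The posterior covariance `(I + σ⁻² Zᵀ Z)⁻¹` of `β` in the model `y = Z β + ε`,
`β ∼ N(0, I)`, `ε ∼ N(0, σ² I)`. -/
noncomputable def posteriorCov {d r M : ℕ} (U : Matrix (Fin d) (Fin r) ℝ) (σ : ℝ)
    (X : Fin M → EuclideanSpace ℝ (Fin d)) : Matrix (Fin r) (Fin r) ℝ :=
  (1 + (1 / σ ^ 2) • ((conceptDesign U X)ᵀ * conceptDesign U X))⁻¹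

/-- The posterior mean `(I + σ⁻² Zᵀ Z)⁻¹ σ⁻² Zᵀ y` of `β` in the same model. -/
noncomputable def posteriorMean {d r M : ℕ} (U : Matrix (Fin d) (Fin r) ℝ) (σ : ℝ)
    (X : Fin M → EuclideanSpace ℝ (Fin d)) (y : Fin M → ℝ) : EuclideanSpace ℝ (Fin r) :=
  WithLp.toLp 2 (posteriorCov U σ X *ᵥ ((1 / σ ^ 2) • ((conceptDesign U X)ᵀ *ᵥ y)))

/-- The Bayes concept predictor `x ↦ μᵀ Uᵀ x`, with `μ` the posterior mean. -/
noncomputable def bayesPred {d r M : ℕ} (U : Matrix (Fin d) (Fin r) ℝ) (σ : ℝ)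
    (X : Fin M → EuclideanSpace ℝ (Fin d)) (y : Fin M → ℝ) (x : EuclideanSpace ℝ (Fin d)) : ℝ :=
  inner ℝ (posteriorMean U σ X y) (conceptCoord U x)

end ConceptICL

/-! Only the nuisance part `b = Vᵀ ŵ` of the ridge estimator sees `v`: since `Uᵀ v = 0`, the change
in prediction is `⟪b, Vᵀ v⟫`, at most `‖b‖ ‖v‖`. So everything reduces to bounding `‖b‖`, a quantity
free of `v` and of the query, which makes the bound simultaneous in `v`.

Write `z i = Uᵀ x i`, `u i = Vᵀ x i`. An energy identity (`norm_nuisance_le`) bounds `‖b‖` by `‖∑ ⟪z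
i, p⟫ u i‖`, where `p` solves `(∑ z i (z i)ᵀ + l₀) p = β`. The gain is that `p` depends on `β` and
the `z i` alone. When `Λ₁₂ = 0` the `u i` are independent of these, so conditionally on them the sum
is Gaussian with covariance `(∑ ⟪z i, p⟫²) Λ₂₂`, and a chi-square tail bound gives the factor `R_⊥`
(`pi_multivariateGaussian_weighted_tail`).

The weights are small: `∑ ⟪z i, p⟫² ≤ ‖β‖² / c` once `∑ z i (z i)ᵀ ≥ c`
(`sum_sq_inner_le_of_coercive`). Concentration of the second moments of the `z i` allows `c` of
order `M`, and `‖β‖²` is of order `r + log (a₀ / δ)`. Three events may fail, each with probability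
at most `δ / 3`, hence `a₀ = 3`.

The Bayes predictor depends on its input only through `Uᵀ x`, so its invariance is immediate. -/

namespace ConceptICL

/-! ### Deterministic ridge inequalities -/

section RidgeAlgebra

variable {ι H K : Type*} [Fintype ι] [NormedAddCommGroup H] [InnerProductSpace ℝ H]
  [NormedAddCommGroup K] [InnerProductSpace ℝ K]

/-- If `(a, b)` solves the ridge normal equations with features `(z i, u i)` and noiseless labels
`⟪z i, β⟫`, then `b` is bounded by the nuisance features averaged against the fit of the ridge
problem on the features `z i` alone. -/
lemma norm_nuisance_le (z : ι → H) (u : ι → K) (β a p : H) (b : K) (l : ℝ) (hl : 0 < l)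
    (ha : l • a = ∑ i, (inner ℝ (z i) (β - a) - inner ℝ (u i) b) • z i)
    (hb : l • b = ∑ i, (inner ℝ (z i) (β - a) - inner ℝ (u i) b) • u i)
    (hp : l • p + ∑ i, inner ℝ (z i) p • z i = β) :
    ‖b‖ ≤ ‖∑ i, inner ℝ (z i) p • u i‖ := by
  -- `β - l • p` is the ridge solution on the features `z i` alone, with residuals `l ⟪z i, p⟫`; `s`
  -- is its displacement from `a`.
  set s := β - a - l • p with hs
  have hρ : ∀ i, inner ℝ (z i) (β - a) = inner ℝ (z i) s + l * inner ℝ (z i) p := by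
    intro i
    rw [hs, inner_sub_right _ (β - a), inner_smul_right]
    ring
  simp only [hρ] at ha hb
  have hls : l • s = ∑ i, (inner ℝ (u i) b - inner ℝ (z i) s) • z i := by
    have h1 : l • a = ∑ i, inner ℝ (z i) s • z i + l • (β - l • p)
        - ∑ i, inner ℝ (u i) b • z i := by
      rw [ha, ← hp]
      simp only [sub_smul, add_smul, Finset.sum_sub_distrib, Finset.sum_add_distrib,
        add_sub_cancel_left, Finset.smul_sum, smul_smul]
    rw [hs]
    simp only [sub_smul, Finset.sum_sub_distrib]
    rw [smul_sub, smul_sub, h1, smul_sub]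
    abel
  have e1 : l * ‖s‖ ^ 2 = ∑ i, (inner ℝ (u i) b - inner ℝ (z i) s) * inner ℝ (z i) s := by
    rw [← real_inner_self_eq_norm_sq, ← real_inner_smul_left, hls, sum_inner]
    simp only [real_inner_smul_left]
  have e2 : l * ‖b‖ ^ 2 = ∑ i, (inner ℝ (z i) s + l * inner ℝ (z i) p - inner ℝ (u i) b)
      * inner ℝ (u i) b := by
    rw [← real_inner_self_eq_norm_sq, ← real_inner_smul_left, hb, sum_inner]
    simp only [real_inner_smul_left]
  have e3 : inner ℝ (∑ i, inner ℝ (z i) p • u i) b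
      = ∑ i, inner ℝ (z i) p * inner ℝ (u i) b := by
    simp only [sum_inner, real_inner_smul_left]
  -- Energy identity: testing the equation for `s` against `s` and that for `b` against `b`, the
  -- cross terms complete a square. Dropping two nonnegative terms and applying Cauchy–Schwarz
  -- leaves the claim.
  have e4 : l * ‖b‖ ^ 2 + l * ‖s‖ ^ 2 + ∑ i, (inner ℝ (u i) b - inner ℝ (z i) s) ^ 2
      = l * inner ℝ (∑ i, inner ℝ (z i) p • u i) b := by
    rw [e1, e2, e3, Finset.mul_sum, ← Finset.sum_add_distrib, ← Finset.sum_add_distrib]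
    exact Finset.sum_congr rfl fun i _ => by ring
  have e5 : 0 ≤ ∑ i, (inner ℝ (u i) b - inner ℝ (z i) s) ^ 2 :=
    Finset.sum_nonneg fun i _ => sq_nonneg _
  have e6 := real_inner_le_norm (∑ i, inner ℝ (z i) p • u i) b
  have e7 : ‖b‖ ^ 2 ≤ ‖∑ i, inner ℝ (z i) p • u i‖ * ‖b‖ := by
    refine le_trans ?_ e6
    refine le_of_mul_le_mul_left ?_ hl
    have : 0 ≤ l * ‖s‖ ^ 2 := by positivity
    linarith
  rcases (norm_nonneg b).eq_or_lt with h | h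
  · rw [← h]; exact norm_nonneg _
  · rw [pow_two] at e7
    exact le_of_mul_le_mul_right e7 h

/-- Pairing the equation with `p` gives `Q ≤ ⟪β, p⟫ ≤ ‖β‖ ‖p‖` for the sum of squares `Q`.
Coercivity bounds `‖p‖²` by `Q / c`, so `Q² ≤ ‖β‖² Q / c`, and one factor `Q` cancels. The bound
does not degenerate as `l → 0`. -/
lemma sum_sq_inner_le_of_coercive (z : ι → H) (β p : H) (l c : ℝ) (hl : 0 ≤ l) (hc : 0 < c)
    (hz : c * ‖p‖ ^ 2 ≤ ∑ i, (inner ℝ (z i) p) ^ 2)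
    (hp : l • p + ∑ i, inner ℝ (z i) p • z i = β) :
    ∑ i, (inner ℝ (z i) p) ^ 2 ≤ ‖β‖ ^ 2 / c := by
  set Q := ∑ i, (inner ℝ (z i) p) ^ 2 with hQ
  have h1 : l * ‖p‖ ^ 2 + Q = inner ℝ β p := by
    rw [← hp, inner_add_left, real_inner_smul_left, real_inner_self_eq_norm_sq, sum_inner, hQ]
    simp only [real_inner_smul_left, pow_two]
  have h2 := real_inner_le_norm β p
  have h3 : 0 ≤ l * ‖p‖ ^ 2 := by positivity
  have hQ0 : 0 ≤ Q := Finset.sum_nonneg fun i _ => sq_nonneg _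
  have h4 : Q ≤ ‖β‖ * ‖p‖ := by linarith
  rw [le_div_iff₀ hc]
  rcases hQ0.eq_or_lt with h | h
  · rw [← h, zero_mul]; positivity
  · have h5 : Q * Q ≤ (‖β‖ * ‖p‖) * (‖β‖ * ‖p‖) := mul_self_le_mul_self hQ0 h4
    have h6 : ‖β‖ ^ 2 * (c * ‖p‖ ^ 2) ≤ ‖β‖ ^ 2 * Q := by gcongr
    refine le_of_mul_le_mul_left (a := Q) ?_ h
    nlinarith

end RidgeAlgebra

/-! ### Ridge systems in matrix form -/

lemma posDef_smul_sum_vecMulVec_add {ι : Type*} {n : ℕ} [Fintype ι]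
    (x : ι → EuclideanSpace ℝ (Fin n)) (c l : ℝ) (hc : 0 ≤ c) (hl : 0 < l) :
    (c • ∑ i, Matrix.vecMulVec (x i).ofLp (x i).ofLp
      + l • (1 : Matrix (Fin n) (Fin n) ℝ)).PosDef := by
  refine Matrix.PosDef.posSemidef_add ?_ (Matrix.PosDef.one.smul hl)
  refine Matrix.PosSemidef.smul ?_ hc
  refine Matrix.posSemidef_sum _ fun i _ => ?_
  simpa using Matrix.posSemidef_vecMulVec_self_star (x i).ofLp

lemma sum_vecMulVec_mulVec {ι : Type*} {n : ℕ} [Fintype ι]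
    (x : ι → EuclideanSpace ℝ (Fin n)) (v : EuclideanSpace ℝ (Fin n)) :
    (∑ i, Matrix.vecMulVec (x i).ofLp (x i).ofLp) *ᵥ v.ofLp
      = (∑ i, inner ℝ (x i) v • x i).ofLp := by
  rw [Matrix.sum_mulVec, WithLp.ofLp_sum]
  refine Finset.sum_congr rfl fun i _ => ?_
  rw [Matrix.vecMulVec_mulVec, EuclideanSpace.inner_eq_star_dotProduct, dotProduct_comm]
  simp

/-- The solution `p` of the dual ridge system `(∑ i, z i (z i)ᵀ + l) p = β`. -/
noncomputable def dualRidge {n M : ℕ} (l : ℝ) (z : Fin M → EuclideanSpace ℝ (Fin n))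
    (β : EuclideanSpace ℝ (Fin n)) : EuclideanSpace ℝ (Fin n) :=
  WithLp.toLp 2 ((∑ i, Matrix.vecMulVec (z i).ofLp (z i).ofLp
    + l • (1 : Matrix (Fin n) (Fin n) ℝ))⁻¹ *ᵥ β.ofLp)

lemma dualRidge_spec {n M : ℕ} (l : ℝ) (hl : 0 < l) (z : Fin M → EuclideanSpace ℝ (Fin n))
    (β : EuclideanSpace ℝ (Fin n)) :
    l • dualRidge l z β + ∑ i, inner ℝ (z i) (dualRidge l z β) • z i = β := by
  have h := (posDef_smul_sum_vecMulVec_add z 1 l zero_le_one hl).isUnit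
  rw [one_smul, Matrix.isUnit_iff_isUnit_det] at h
  apply WithLp.ofLp_injective 2
  rw [WithLp.ofLp_add, ← sum_vecMulVec_mulVec, WithLp.ofLp_smul, add_comm,
    show l • (dualRidge l z β).ofLp = (l • (1 : Matrix (Fin n) (Fin n) ℝ)) *ᵥ
      (dualRidge l z β).ofLp by rw [Matrix.smul_mulVec, Matrix.one_mulVec], ← Matrix.add_mulVec,
    dualRidge, Matrix.mulVec_mulVec, Matrix.mul_nonsing_inv _ h, Matrix.one_mulVec]

lemma measurable_dualRidge {n M : ℕ} (l : ℝ) :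
    Measurable fun ω : EuclideanSpace ℝ (Fin n) × (Fin M → EuclideanSpace ℝ (Fin n)) =>
      dualRidge l ω.2 ω.1 := by
  have hA : Continuous fun ω : EuclideanSpace ℝ (Fin n) × (Fin M → EuclideanSpace ℝ (Fin n)) =>
      (∑ i, Matrix.vecMulVec (ω.2 i).ofLp (ω.2 i).ofLp + l • (1 : Matrix (Fin n) (Fin n) ℝ)) := by
    refine Continuous.add (continuous_finsetSum _ fun i _ => ?_) continuous_const
    exact Continuous.matrix_vecMulVec (by fun_prop) (by fun_prop)
  unfold dualRidge
  -- Writing the inverse as `det⁻¹ • adjugate` gives measurability for every `l`, with no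
  -- invertibility assumption.
  simp only [Matrix.inv_def, Ring.inverse_eq_inv', Matrix.smul_mulVec]
  refine (WithLp.measurable_toLp 2 _).comp (Measurable.fun_smul ?_ ?_)
  · exact hA.matrix_det.measurable.inv
  · exact (Continuous.matrix_mulVec hA.matrix_adjugate (by fun_prop)).measurable

lemma ridgeEst_normal {d M : ℕ} (hM : 0 < M) (l₀ : ℝ) (hl : 0 < l₀)
    (X : Fin M → EuclideanSpace ℝ (Fin d)) (w : EuclideanSpace ℝ (Fin d)) :
    l₀ • ridgeEst (l₀ / M) X (labels w X)
      = ∑ i, (inner ℝ (X i) w - inner ℝ (X i) (ridgeEst (l₀ / M) X (labels w X))) • X i := by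
  have hM' : (0 : ℝ) < M := by exact_mod_cast hM
  have h := (posDef_smul_sum_vecMulVec_add X (1 / (M : ℝ)) (l₀ / M) (by positivity)
    (by positivity)).isUnit
  rw [Matrix.isUnit_iff_isUnit_det] at h
  set e := ridgeEst (l₀ / M) X (labels w X) with he
  have h1 : (empCov X + (l₀ / M) • (1 : Matrix (Fin d) (Fin d) ℝ)) *ᵥ e.ofLp
      = (1 / (M : ℝ)) • ∑ i, labels w X i • (X i).ofLp := by
    rw [he, ridgeEst, Matrix.mulVec_mulVec, empCov, Matrix.mul_nonsing_inv _ h,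
      Matrix.one_mulVec]
  rw [Matrix.add_mulVec, empCov, Matrix.smul_mulVec, Matrix.smul_mulVec, Matrix.one_mulVec,
    sum_vecMulVec_mulVec] at h1
  -- Multiplying by `M` turns the parameter `l₀ / M` into the fixed `l₀` and removes the averaging.
  have h2 := congrArg (fun v => (M : ℝ) • v) h1
  simp only [smul_add, smul_smul, mul_one_div_cancel hM'.ne', mul_div_cancel₀ l₀ hM'.ne',
    one_smul] at h2
  apply WithLp.ofLp_injective 2
  simp only [sub_smul, Finset.sum_sub_distrib]
  rw [WithLp.ofLp_smul, WithLp.ofLp_sub, eq_sub_iff_add_eq, add_comm, h2, WithLp.ofLp_sum]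
  simp [labels, real_inner_comm]

/-! ### Concept and nuisance coordinates -/

/-- `conceptCoord` as a continuous linear map. -/
noncomputable def coordCLM {d r : ℕ} (U : Matrix (Fin d) (Fin r) ℝ) :
    EuclideanSpace ℝ (Fin d) →L[ℝ] EuclideanSpace ℝ (Fin r) :=
  (Matrix.toEuclideanLin Uᵀ).toContinuousLinearMap

lemma coordCLM_apply {d r : ℕ} (U : Matrix (Fin d) (Fin r) ℝ) (x : EuclideanSpace ℝ (Fin d)) :
    coordCLM U x = conceptCoord U x := rfl

lemma inner_conceptCoord {d r : ℕ} (U : Matrix (Fin d) (Fin r) ℝ) (x : EuclideanSpace ℝ (Fin d))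
    (β : EuclideanSpace ℝ (Fin r)) :
    inner ℝ (conceptCoord U x) β = inner ℝ x (taskParam U β) := by
  simp only [EuclideanSpace.inner_eq_star_dotProduct, conceptCoord, taskParam, star_trivial]
  rw [Matrix.mulVec_transpose, dotProduct_comm, ← Matrix.dotProduct_mulVec, dotProduct_comm]

lemma conceptCoord_eq_zero_of_mem {d r : ℕ} (U : Matrix (Fin d) (Fin r) ℝ)
    (v : EuclideanSpace ℝ (Fin d)) (hv : v ∈ (colSpan U)ᗮ) : conceptCoord U v = 0 := by
  ext j
  have := (Submodule.mem_orthogonal _ v).1 hv (WithLp.toLp 2 fun i => U i j)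
    (Submodule.subset_span ⟨j, rfl⟩)
  rw [EuclideanSpace.inner_eq_star_dotProduct, star_trivial, dotProduct_comm] at this
  exact this

section Orthogonal

variable {d r : ℕ} {U : Matrix (Fin d) (Fin r) ℝ} {V : Matrix (Fin d) (Fin (d - r)) ℝ}

lemma mul_transpose_add_mul_transpose (hrd : r ≤ d) (hU : Uᵀ * U = 1) (hV : Vᵀ * V = 1)
    (hUV : Uᵀ * V = 0) : U * Uᵀ + V * Vᵀ = 1 := by
  have hVU : Vᵀ * U = 0 := by
    rw [← Matrix.transpose_transpose (Vᵀ * U), Matrix.transpose_mul, Matrix.transpose_transpose,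
      hUV, Matrix.transpose_zero]
  have h1 : Matrix.fromRows Uᵀ Vᵀ * Matrix.fromCols U V = 1 := by
    rw [Matrix.fromRows_mul_fromCols, hU, hV, hUV, hVU, Matrix.fromBlocks_one]
  -- `[U V]` is square because `r + (d - r) = d`, so its left inverse is also a right inverse.
  have h2 := (Matrix.mul_eq_one_comm_of_card_eq (Fin r ⊕ Fin (d - r)) (Fin d) ℝ
    (by simp only [Fintype.card_sum, Fintype.card_fin]; omega)).1 h1
  rwa [Matrix.fromCols_mul_fromRows] at h2

lemma inner_eq_add_conceptCoord (h : U * Uᵀ + V * Vᵀ = 1) (x y : EuclideanSpace ℝ (Fin d)) :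
    inner ℝ x y = inner ℝ (conceptCoord U x) (conceptCoord U y)
      + inner ℝ (conceptCoord V x) (conceptCoord V y) := by
  rw [inner_conceptCoord, inner_conceptCoord, ← inner_add_right]
  congr 1
  apply WithLp.ofLp_injective 2
  simp only [taskParam, conceptCoord, WithLp.ofLp_add, Matrix.mulVec_mulVec]
  rw [← Matrix.add_mulVec, h, Matrix.one_mulVec]

lemma conceptCoord_taskParam (hU : Uᵀ * U = 1) (β : EuclideanSpace ℝ (Fin r)) :
    conceptCoord U (taskParam U β) = β := by
  apply WithLp.ofLp_injective 2
  simp only [taskParam, conceptCoord, Matrix.mulVec_mulVec, hU, Matrix.one_mulVec]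

/-- Deterministic stability bound for the ambient ridge predictor. -/
lemma abs_ridgePred_sub_le (hrd : r ≤ d) (hU : Uᵀ * U = 1) (hV : Vᵀ * V = 1) (hUV : Uᵀ * V = 0)
    {M : ℕ} (hM : 0 < M) (l₀ : ℝ) (hl : 0 < l₀) (X : Fin M → EuclideanSpace ℝ (Fin d))
    (β : EuclideanSpace ℝ (Fin r)) (x v : EuclideanSpace ℝ (Fin d)) (hv : v ∈ (colSpan U)ᗮ) :
    |ridgePred (l₀ / M) X (labels (taskParam U β) X) (x + v)
      - ridgePred (l₀ / M) X (labels (taskParam U β) X) x|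
    ≤ ‖∑ i, inner ℝ (conceptCoord U (X i)) (dualRidge l₀ (fun i => conceptCoord U (X i)) β)
        • conceptCoord V (X i)‖ * ‖v‖ := by
  have hI := mul_transpose_add_mul_transpose hrd hU hV hUV
  have hv0 := conceptCoord_eq_zero_of_mem U v hv
  rw [ridgePred, ridgePred, inner_add_right, add_sub_cancel_left]
  have hn := ridgeEst_normal hM l₀ hl X (taskParam U β)
  set e := ridgeEst (l₀ / M) X (labels (taskParam U β) X)
  have hvn : ‖conceptCoord V v‖ = ‖v‖ := by
    have := inner_eq_add_conceptCoord hI v v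
    rw [hv0, inner_zero_left, zero_add, real_inner_self_eq_norm_sq,
      real_inner_self_eq_norm_sq] at this
    exact ((sq_eq_sq₀ (norm_nonneg _) (norm_nonneg _)).1 this).symm
  have hρ : ∀ i, inner ℝ (X i) (taskParam U β) - inner ℝ (X i) e
      = inner ℝ (conceptCoord U (X i)) (β - conceptCoord U e)
        - inner ℝ (conceptCoord V (X i)) (conceptCoord V e) := by
    intro i
    rw [inner_eq_add_conceptCoord hI (X i) e, ← inner_conceptCoord, inner_sub_right]
    ring
  simp only [hρ] at hn
  -- Projecting the normal equation by `Uᵀ` and `Vᵀ` yields the coupled system of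
  -- `norm_nuisance_le`.
  have ha := congrArg (coordCLM U) hn
  have hb := congrArg (coordCLM V) hn
  simp only [map_smul, map_sum, coordCLM_apply] at ha hb
  have key := norm_nuisance_le _ _ β _ _ _ l₀ hl ha hb
    (dualRidge_spec l₀ hl (fun i => conceptCoord U (X i)) β)
  rw [inner_eq_add_conceptCoord hI, hv0, inner_zero_right, zero_add]
  refine (abs_real_inner_le_norm _ _).trans ?_
  rw [hvn]
  gcongr

lemma bayesPred_add_orthogonal {M : ℕ} (σ : ℝ) (X : Fin M → EuclideanSpace ℝ (Fin d))
    (y : Fin M → ℝ) (x v : EuclideanSpace ℝ (Fin d)) (hv : v ∈ (colSpan U)ᗮ) :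
    bayesPred U σ X y (x + v) = bayesPred U σ X y x := by
  have := map_add (coordCLM U) x v
  simp only [coordCLM_apply, conceptCoord_eq_zero_of_mem U v hv, add_zero] at this
  rw [bayesPred, bayesPred, this]

end Orthogonal

/-! ### Gaussian quadratic tails -/

section Tails

lemma integrable_exp_mul_sq_gaussianReal {c : ℝ} (hc : c < 1 / 2) :
    Integrable (fun x : ℝ => Real.exp (c * x ^ 2)) (gaussianReal 0 1) := by
  rw [gaussianReal_of_var_ne_zero _ one_ne_zero,
    integrable_withDensity_iff_integrable_smul' (measurable_gaussianPDF _ _)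
      (ae_of_all _ fun _ => gaussianPDF_lt_top)]
  have h := (integrable_exp_neg_mul_sq (b := 1 / 2 - c) (by linarith)).const_mul
    (Real.sqrt (2 * Real.pi))⁻¹
  refine h.congr (ae_of_all _ fun x => ?_)
  simp only [toReal_gaussianPDF, gaussianPDFReal, NNReal.coe_one, smul_eq_mul, mul_one]
  rw [mul_assoc, ← Real.exp_add]
  congr 2
  ring

lemma integral_exp_mul_sq_gaussianReal_le {c : ℝ} (hc₀ : 0 ≤ c) (hc : c ≤ 1 / 4) :
    ∫ x, Real.exp (c * x ^ 2) ∂(gaussianReal 0 1) ≤ Real.exp (2 * c) := by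
  have h : ∫ x, Real.exp (c * x ^ 2) ∂(gaussianReal 0 1)
      = (Real.sqrt (2 * Real.pi))⁻¹ * Real.sqrt (Real.pi / (1 / 2 - c)) := by
    rw [integral_gaussianReal_eq_integral_smul one_ne_zero, ← integral_gaussian,
      ← integral_const_mul]
    refine integral_congr_ae (ae_of_all _ fun x => ?_)
    simp only [gaussianPDFReal, NNReal.coe_one, smul_eq_mul, mul_one]
    rw [mul_assoc, ← Real.exp_add]
    congr 2
    ring
  rw [h, ← Real.sqrt_inv, ← Real.sqrt_mul (by positivity)]
  apply Real.sqrt_le_iff.2 ⟨(Real.exp_pos _).le, ?_⟩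
  rw [← Real.exp_nat_mul]
  have h1 : (2 * Real.pi)⁻¹ * (Real.pi / (1 / 2 - c)) = 1 / (1 - 2 * c) := by
    have := Real.pi_ne_zero
    have h3 : (1 : ℝ) / 2 - c ≠ 0 := by linarith
    have h4 : (1 : ℝ) - 2 * c ≠ 0 := by linarith
    field_simp
  rw [h1, div_le_iff₀ (by linarith)]
  have h2 := Real.add_one_le_exp (((2 : ℕ) : ℝ) * (2 * c))
  have h3 : (((2 : ℕ) : ℝ) * (2 * c) + 1) * (1 - 2 * c)
      ≤ Real.exp (((2 : ℕ) : ℝ) * (2 * c)) * (1 - 2 * c) :=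
    mul_le_mul_of_nonneg_right h2 (by linarith)
  push_cast at h3 ⊢
  -- The inequality left is `(1 + 4c)(1 - 2c) ≥ 1`, which holds exactly for `0 ≤ c ≤ 1/4`.
  nlinarith

lemma pi_gaussianReal_sum_mul_sq_tail {k : ℕ} (a : Fin k → ℝ) (L t : ℝ) (hL₀ : 0 ≤ L) (ha : ∀ i, 0 ≤ a i)
    (haL : ∀ i, a i ≤ L) :
    (Measure.pi fun _ : Fin k => gaussianReal 0 1)
      {x | 2 * ∑ i, a i + 4 * L * t < ∑ i, a i * x i ^ 2} ≤ ENNReal.ofReal (Real.exp (-t)) := by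
  rcases le_or_gt L 0 with hL | hL
  · have h0 : ∀ i, a i = 0 := fun i => le_antisymm ((haL i).trans hL) (ha i)
    simp [h0, le_antisymm hL hL₀]
  set μ := Measure.pi fun _ : Fin k => gaussianReal 0 1
  -- The Chernoff parameter: the largest `s` for which every `s * a i ≤ 1/4` follows from `a i ≤ L`.
  set s := 1 / (4 * L) with hs
  have hs0 : 0 < s := by positivity
  have hsa : ∀ i, s * a i ≤ 1 / 4 := by
    intro i
    rw [hs, div_mul_eq_mul_div, one_mul, div_le_div_iff₀ (by positivity) (by norm_num)]
    linarith [haL i]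
  have hexp : ∀ x : Fin k → ℝ, Real.exp (s * ∑ i, a i * x i ^ 2)
      = ∏ i, Real.exp (s * a i * x i ^ 2) := by
    intro x
    rw [← Real.exp_sum, Finset.mul_sum]
    simp only [mul_assoc]
  have hint : Integrable (fun x : Fin k → ℝ => Real.exp (s * ∑ i, a i * x i ^ 2)) μ := by
    simp only [hexp]
    exact Integrable.fintype_prod fun i =>
      integrable_exp_mul_sq_gaussianReal (by linarith [hsa i])
  have hmgf : mgf (fun x : Fin k → ℝ => ∑ i, a i * x i ^ 2) μ s
      ≤ Real.exp (2 * s * ∑ i, a i) := by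
    rw [mgf]
    simp only [hexp]
    rw [integral_fintype_prod_eq_prod (f := fun i (y : ℝ) => Real.exp (s * a i * y ^ 2)),
      Finset.mul_sum, Real.exp_sum]
    refine Finset.prod_le_prod (fun i _ => integral_nonneg fun _ => (Real.exp_pos _).le)
      fun i _ => ?_
    rw [mul_assoc 2 s]
    exact integral_exp_mul_sq_gaussianReal_le (mul_nonneg hs0.le (ha i)) (hsa i)
  have h := measure_ge_le_exp_mul_mgf (2 * ∑ i, a i + 4 * L * t) hs0.le hint
  rw [← ENNReal.ofReal_toReal (measure_ne_top μ _)]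
  apply ENNReal.ofReal_le_ofReal
  calc μ.real {x | 2 * ∑ i, a i + 4 * L * t < ∑ i, a i * x i ^ 2}
    _ ≤ μ.real {x | 2 * ∑ i, a i + 4 * L * t ≤ ∑ i, a i * x i ^ 2} :=
        measureReal_mono fun x hx => by
          rw [Set.mem_ofPred_eq] at hx ⊢
          exact hx.le
    _ ≤ _ := h
    _ ≤ Real.exp (-s * (2 * ∑ i, a i + 4 * L * t)) * Real.exp (2 * s * ∑ i, a i) := by gcongr
    _ = Real.exp (-t) := by
      rw [← Real.exp_add]
      congr 1
      rw [hs]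
      field_simp
      ring

/-- Rotating the standard Gaussian into an eigenbasis of `S` turns `‖√S x‖²` into a weighted
chi-square sum whose weights are the eigenvalues: they add up to the trace and are at most the
operator norm. -/
lemma multivariateGaussian_norm_sq_tail {k : ℕ} (S : Matrix (Fin k) (Fin k) ℝ)
    (hS : S.PosSemidef) (t : ℝ) :
    multivariateGaussian 0 S
      {x | 2 * S.trace + 4 * ‖Matrix.toEuclideanCLM (n := Fin k) (𝕜 := ℝ) S‖ * t < ‖x‖ ^ 2}
      ≤ ENNReal.ofReal (Real.exp (-t)) := by
  open scoped MatrixOrder in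
  set b := hS.isHermitian.eigenvectorBasis
  set a := hS.isHermitian.eigenvalues
  have hSb : ∀ i, Matrix.toEuclideanCLM (n := Fin k) (𝕜 := ℝ) S (b i) = a i • b i := fun i =>
    WithLp.ofLp_injective 2 (hS.isHermitian.mulVec_eigenvectorBasis i)
  have hnorm : ∀ x : Fin k → ℝ,
      ‖Matrix.toEuclideanCLM (n := Fin k) (𝕜 := ℝ) (CFC.sqrt S) (∑ i, x i • b i)‖ ^ 2
        = ∑ i, a i * x i ^ 2 := by
    intro x
    have hsa : IsSelfAdjoint (Matrix.toEuclideanCLM (n := Fin k) (𝕜 := ℝ) (CFC.sqrt S)) :=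
      (CFC.sqrt_nonneg S).isSelfAdjoint.map _
    rw [← real_inner_self_eq_norm_sq, ← ContinuousLinearMap.adjoint_inner_right, hsa.adjoint_eq,
      ← ContinuousLinearMap.comp_apply, ← ContinuousLinearMap.mul_def, ← map_mul,
      CFC.sqrt_mul_sqrt_self _ hS.nonneg, map_sum]
    simp only [map_smul, hSb, smul_smul]
    rw [b.orthonormal.inner_sum]
    exact Finset.sum_congr rfl fun i _ => by simp; ring
  have htr : S.trace = ∑ i, a i := by
    simpa using hS.isHermitian.trace_eq_sum_eigenvalues
  have haL : ∀ i, a i ≤ ‖Matrix.toEuclideanCLM (n := Fin k) (𝕜 := ℝ) S‖ := by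
    intro i
    have := (Matrix.toEuclideanCLM (n := Fin k) (𝕜 := ℝ) S).le_opNorm (b i)
    rw [hSb, norm_smul, b.orthonormal.1 i, mul_one, mul_one] at this
    exact (le_abs_self _).trans this
  rw [multivariateGaussian, stdGaussian_eq_map_pi_orthonormalBasis b,
    Measure.map_map (by fun_prop) (by fun_prop), Measure.map_apply (by fun_prop)
      (measurableSet_lt measurable_const (by fun_prop))]
  have := pi_gaussianReal_sum_mul_sq_tail a _ t (norm_nonneg _) (fun i => hS.eigenvalues_nonneg i) haL
  simpa only [Set.preimage_ofPred_eq, Function.comp_apply, zero_add, hnorm, htr] using this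

lemma map_sum_smul_pi_multivariateGaussian {k M : ℕ} (S : Matrix (Fin k) (Fin k) ℝ)
    (hS : S.PosSemidef) (q : Fin M → ℝ) :
    (Measure.pi fun _ : Fin M => multivariateGaussian 0 S).map (fun u => ∑ i, q i • u i)
      = multivariateGaussian 0 ((∑ i, q i ^ 2) • S) := by
  have h1 : (Measure.pi fun _ : Fin M => multivariateGaussian 0 S).map (fun u => ∑ i, q i • u i)
      = (Measure.pi fun i : Fin M => (multivariateGaussian 0 S).map (fun x => q i • x)).map
        (fun p => ∑ i, p i) := by
    rw [← Measure.pi_map_pi (by fun_prop), Measure.map_map (by fun_prop) (by fun_prop)]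
    rfl
  rw [h1]
  have : ∀ i, IsProbabilityMeasure ((multivariateGaussian 0 S).map (fun x => q i • x)) :=
    fun i => Measure.isProbabilityMeasure_map (by fun_prop)
  apply Measure.ext_of_charFun
  rw [charFun_map_sum_pi_eq_prod]
  ext t
  rw [Finset.prod_apply, charFun_multivariateGaussian (hS.smul (Finset.sum_nonneg fun i _ =>
    sq_nonneg _))]
  simp only [charFun_map_smul, charFun_multivariateGaussian hS, ← Complex.exp_sum]
  congr 1
  simp [Matrix.smul_mulVec, Matrix.mulVec_smul, Finset.sum_mul, Finset.sum_div]
  exact Finset.sum_congr rfl fun i _ => by ring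

lemma pi_multivariateGaussian_weighted_tail {k M : ℕ} (S : Matrix (Fin k) (Fin k) ℝ)
    (hS : S.PosSemidef) (q : Fin M → ℝ) (t : ℝ) :
    (Measure.pi fun _ : Fin M => multivariateGaussian 0 S)
      {u | (∑ i, q i ^ 2) *
        (2 * S.trace + 4 * ‖Matrix.toEuclideanCLM (n := Fin k) (𝕜 := ℝ) S‖ * t)
        < ‖∑ i, q i • u i‖ ^ 2} ≤ ENNReal.ofReal (Real.exp (-t)) := by
  have hq : 0 ≤ ∑ i, q i ^ 2 := Finset.sum_nonneg fun i _ => sq_nonneg _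
  have h := multivariateGaussian_norm_sq_tail _ (hS.smul hq) t
  rw [← map_sum_smul_pi_multivariateGaussian S hS q, Measure.map_apply (by fun_prop)
      (measurableSet_lt measurable_const (by fun_prop))] at h
  refine le_trans (le_of_eq ?_) h
  congr 1
  ext u
  simp only [Set.preimage_ofPred_eq, Set.mem_ofPred_eq, Matrix.trace_smul, map_smul, norm_smul,
    Real.norm_of_nonneg hq, smul_eq_mul]
  rw [mul_add, ← mul_assoc, ← mul_assoc, ← mul_assoc, ← mul_assoc, mul_comm _ (2 : ℝ),
    mul_comm _ (4 : ℝ), ← mul_assoc]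

end Tails

/-! ### Exponential concentration of empirical second moments -/

section EmpiricalMean

/-- Chernoff's bound with an unspecified rate. The cumulant generating function has slope `μ[f]` at
`0`, so `cgf t - t (μ[f] + ε)` starts at `0` with slope `-ε` and is negative at some small `t > 0`.
Its negative there is the rate, independent of `M`. -/
lemma exists_pi_sum_ge_le_exp {Ω : Type*} [MeasurableSpace Ω] (μ : Measure Ω)
    [IsProbabilityMeasure μ] (f : Ω → ℝ) (h0 : 0 ∈ interior (integrableExpSet f μ))
    {ε : ℝ} (hε : 0 < ε) :
    ∃ c : ℝ, 0 < c ∧ ∀ M : ℕ, (Measure.pi fun _ : Fin M => μ)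
      {x | M * (μ[f] + ε) ≤ ∑ i, f (x i)} ≤ ENNReal.ofReal (Real.exp (-(c * M))) := by
  have hd : HasDerivAt (fun t => cgf f μ t - t * (μ[f] + ε)) (-ε) 0 := by
    have h1 : HasDerivAt (cgf f μ) (μ[f]) 0 := by
      have := (analyticAt_cgf h0).differentiableAt.hasDerivAt
      rwa [deriv_cgf_zero h0, probReal_univ, div_one] at this
    have h2 := h1.sub ((hasDerivAt_id (0 : ℝ)).mul_const (μ[f] + ε))
    convert! h2 using 1
    ring
  obtain ⟨t, ht0, htint, hneg⟩ : ∃ t : ℝ, 0 < t ∧ t ∈ integrableExpSet f μ ∧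
      cgf f μ t - t * (μ[f] + ε) < 0 := by
    have h1 := hd.tendsto_slope_zero_right.eventually_lt_const (neg_lt_zero.2 hε)
    have h2 : ∀ᶠ t in nhdsWithin (0 : ℝ) (Set.Ioi 0), t ∈ integrableExpSet f μ :=
      nhdsWithin_le_nhds (mem_interior_iff_mem_nhds.1 h0)
    obtain ⟨t, ⟨ht1, ht2⟩, ht3⟩ := ((h1.and h2).and self_mem_nhdsWithin).exists
    refine ⟨t, ht3, ht2, ?_⟩
    have ht3' : (0 : ℝ) < t := ht3
    simp only [zero_add, cgf_zero, zero_mul, sub_zero, smul_eq_mul] at ht1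
    exact neg_of_mul_neg_right ht1 (inv_pos.2 ht3').le
  refine ⟨-(cgf f μ t - t * (μ[f] + ε)), by linarith, fun M => ?_⟩
  have hexp : ∀ x : Fin M → Ω, Real.exp (t * ∑ i, f (x i)) = ∏ i, Real.exp (t * f (x i)) := by
    intro x
    rw [← Real.exp_sum, Finset.mul_sum]
  have hint : Integrable (fun x : Fin M → Ω => Real.exp (t * ∑ i, f (x i)))
      (Measure.pi fun _ : Fin M => μ) := by
    simp only [hexp]
    exact Integrable.fintype_prod fun i => htint
  have hmgf : mgf (fun x : Fin M → Ω => ∑ i, f (x i)) (Measure.pi fun _ : Fin M => μ) t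
      = Real.exp (M * cgf f μ t) := by
    rw [mgf]
    simp only [hexp]
    rw [integral_fintype_prod_eq_prod (f := fun i (y : Ω) => Real.exp (t * f y)),
      Real.exp_nat_mul, exp_cgf htint, Finset.prod_const, Finset.card_univ, Fintype.card_fin]
    rfl
  have h := measure_ge_le_exp_mul_mgf (M * (μ[f] + ε)) ht0.le hint
  rw [← ENNReal.ofReal_toReal (measure_ne_top _ _)]
  apply ENNReal.ofReal_le_ofReal
  refine h.trans (le_of_eq ?_)
  rw [hmgf, ← Real.exp_add]
  congr 1
  ring

lemma zero_mem_interior_integrableExpSet_mul_coord {r : ℕ}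
    (μ : Measure (EuclideanSpace ℝ (Fin r))) [IsGaussian μ] (s : ℝ) (hs : |s| ≤ 1)
    (j k : Fin r) :
    0 ∈ interior (integrableExpSet (fun x : EuclideanSpace ℝ (Fin r) => s * (x j * x k)) μ) := by
  obtain ⟨C, hC, hint⟩ := IsGaussian.exists_integrable_exp_sq μ
  rw [mem_interior_iff_mem_nhds]
  filter_upwards [Ioo_mem_nhds (neg_lt_zero.2 hC) hC] with t ht
  refine hint.mono' (by fun_prop) (ae_of_all _ fun x => ?_)
  rw [Real.norm_of_nonneg (Real.exp_pos _).le, Real.exp_le_exp]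
  have hj : |x j| ≤ ‖x‖ := PiLp.norm_apply_le x j
  have hk : |x k| ≤ ‖x‖ := PiLp.norm_apply_le x k
  calc t * (s * (x j * x k)) ≤ |t * (s * (x j * x k))| := le_abs_self _
    _ = |t| * (|s| * (|x j| * |x k|)) := by simp only [abs_mul]
    _ ≤ C * (1 * (‖x‖ * ‖x‖)) := by
      gcongr
      exact (abs_lt.2 ht).le
    _ = C * ‖x‖ ^ 2 := by ring

lemma integral_mul_coord_multivariateGaussian {r : ℕ} (S : Matrix (Fin r) (Fin r) ℝ)
    (hS : S.PosSemidef) (j k : Fin r) :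
    ∫ x, x j * x k ∂(multivariateGaussian 0 S) = S j k := by
  have hm : ∀ i : Fin r, MemLp (fun x : EuclideanSpace ℝ (Fin r) => x i) 2
      (multivariateGaussian 0 S) := fun i =>
    (IsGaussian.memLp_two_id (μ := multivariateGaussian 0 S)).continuousLinearMap_comp
      (EuclideanSpace.proj (𝕜 := ℝ) i)
  have h0 : ∀ i : Fin r, ∫ x, x i ∂(multivariateGaussian 0 S) = 0 := by
    intro i
    have := (EuclideanSpace.proj (𝕜 := ℝ) i).integral_comp_id_comm
      (μ := multivariateGaussian 0 S) IsGaussian.integrable_id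
    rw [integral_id_multivariateGaussian, map_zero] at this
    exact this
  have h := covariance_eq_sub (hm j) (hm k)
  rw [covariance_eval_multivariateGaussian hS, h0, zero_mul, sub_zero] at h
  exact h.symm

/-- The empirical second moments of a centred Gaussian sample concentrate exponentially fast. -/
lemma exists_pi_second_moment_tail {r : ℕ} (S : Matrix (Fin r) (Fin r) ℝ) (hS : S.PosSemidef)
    {ε : ℝ} (hε : 0 < ε) :
    ∃ c : ℝ, 0 < c ∧ ∀ M : ℕ, (Measure.pi fun _ : Fin M => multivariateGaussian 0 S)
      {z | ∃ j k, M * ε < |∑ i, z i j * z i k - M * S j k|}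
        ≤ ENNReal.ofReal (2 * r ^ 2 * Real.exp (-(c * M))) := by
  have hmean : ∀ s : ℝ, ∀ j k : Fin r, ∫ x, s * (x j * x k) ∂(multivariateGaussian 0 S)
      = s * S j k := fun s j k => by
    rw [integral_const_mul, integral_mul_coord_multivariateGaussian S hS]
  have hA : ∀ s : ℝ, |s| ≤ 1 → ∀ j k : Fin r, ∃ c : ℝ, 0 < c ∧ ∀ M : ℕ,
      (Measure.pi fun _ : Fin M => multivariateGaussian 0 S)
        {z | M * (s * S j k + ε) ≤ ∑ i, s * (z i j * z i k)}
          ≤ ENNReal.ofReal (Real.exp (-(c * M))) := fun s hs j k => by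
    have := exists_pi_sum_ge_le_exp (multivariateGaussian 0 S)
      (fun x : EuclideanSpace ℝ (Fin r) => s * (x j * x k))
      (zero_mem_interior_integrableExpSet_mul_coord _ s hs j k) hε
    rwa [hmean] at this
  choose c1 hc1 h1 using hA 1 (by simp)
  choose c2 hc2 h2 using hA (-1) (by simp)
  -- A common rate is the minimum over finitely many entries and both signs; for `r = 0` there are
  -- none and `1` serves.
  obtain ⟨c, hc, hcle⟩ : ∃ c : ℝ, 0 < c ∧ ∀ j k, c ≤ c1 j k ∧ c ≤ c2 j k := by
    rcases isEmpty_or_nonempty (Fin r × Fin r) with h | h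
    · exact ⟨1, one_pos, fun j k => (h.false (j, k)).elim⟩
    · obtain ⟨p, hp⟩ := Finite.exists_min
        (fun p : Fin r × Fin r => min (c1 p.1 p.2) (c2 p.1 p.2))
      exact ⟨_, lt_min (hc1 p.1 p.2) (hc2 p.1 p.2), fun j k =>
        ⟨(hp (j, k)).trans (min_le_left _ _), (hp (j, k)).trans (min_le_right _ _)⟩⟩
  refine ⟨c, hc, fun M => ?_⟩
  set P := Measure.pi fun _ : Fin M => multivariateGaussian 0 S
  have hsub : {z : Fin M → EuclideanSpace ℝ (Fin r) |
      ∃ j k, M * ε < |∑ i, z i j * z i k - M * S j k|} ⊆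
      ⋃ p : Fin r × Fin r, ({z | M * (1 * S p.1 p.2 + ε) ≤ ∑ i, 1 * (z i p.1 * z i p.2)} ∪
        {z | M * (-1 * S p.1 p.2 + ε) ≤ ∑ i, -1 * (z i p.1 * z i p.2)}) := by
    rintro z ⟨j, k, hz⟩
    refine Set.mem_iUnion.2 ⟨(j, k), ?_⟩
    simp only [Set.mem_union, Set.mem_ofPred_eq, ← Finset.mul_sum]
    rcases lt_abs.1 hz with h | h
    · left; linarith
    · right; linarith
  have hmono : ∀ c' : ℝ, c ≤ c' → ENNReal.ofReal (Real.exp (-(c' * M)))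
      ≤ ENNReal.ofReal (Real.exp (-(c * M))) := fun c' h => by gcongr
  calc P _ ≤ P (⋃ p : Fin r × Fin r, _) := measure_mono hsub
    _ ≤ ∑ p : Fin r × Fin r, P _ := measure_iUnion_fintype_le _ _
    _ ≤ ∑ _p : Fin r × Fin r, (ENNReal.ofReal (Real.exp (-(c * M)))
        + ENNReal.ofReal (Real.exp (-(c * M)))) := by
      refine Finset.sum_le_sum fun p _ => (measure_union_le _ _).trans (add_le_add ?_ ?_)
      · exact (h1 p.1 p.2 M).trans (hmono _ (hcle p.1 p.2).1)
      · exact (h2 p.1 p.2 M).trans (hmono _ (hcle p.1 p.2).2)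
    _ = _ := by
      rw [Finset.sum_const, Finset.card_univ, Fintype.card_prod, Fintype.card_fin,
        ← ENNReal.ofReal_add (Real.exp_pos _).le (Real.exp_pos _).le,
        ← ENNReal.ofReal_nsmul]
      congr 1
      rw [nsmul_eq_mul]
      push_cast
      ring

end EmpiricalMean

/-! ### Coercivity of the empirical covariance -/

lemma exists_coercive_of_posDef {n : ℕ} (S : Matrix (Fin n) (Fin n) ℝ) (hS : S.PosDef) :
    ∃ m : ℝ, 0 < m ∧ ∀ p : EuclideanSpace ℝ (Fin n), m * ‖p‖ ^ 2 ≤ p.ofLp ⬝ᵥ S *ᵥ p.ofLp := by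
  have hcont : Continuous fun p : EuclideanSpace ℝ (Fin n) => p.ofLp ⬝ᵥ S *ᵥ p.ofLp :=
    Continuous.dotProduct (by fun_prop) (Continuous.matrix_mulVec continuous_const (by fun_prop))
  have hpos : ∀ p : EuclideanSpace ℝ (Fin n), p ≠ 0 → 0 < p.ofLp ⬝ᵥ S *ᵥ p.ofLp := by
    intro p hp
    have := hS.dotProduct_mulVec_pos (x := p.ofLp) (by simpa using hp)
    simpa using this
  rcases (Metric.sphere (0 : EuclideanSpace ℝ (Fin n)) 1).eq_empty_or_nonempty with h | h
  · refine ⟨1, one_pos, fun p => ?_⟩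
    have hp : p = 0 := by
      by_contra hp
      have : ‖p‖⁻¹ • p ∈ Metric.sphere (0 : EuclideanSpace ℝ (Fin n)) 1 := by
        rw [mem_sphere_zero_iff_norm, norm_smul, norm_inv, norm_norm,
          inv_mul_cancel₀ (norm_ne_zero_iff.2 hp)]
      simp [h] at this
    simp [hp]
  · obtain ⟨p₀, hp₀, hmin⟩ := (isCompact_sphere _ _).exists_isMinOn h hcont.continuousOn
    have hp₀' : p₀ ≠ 0 := by
      rintro rfl
      simp at hp₀
    refine ⟨_, hpos p₀ hp₀', fun p => ?_⟩
    rcases eq_or_ne p 0 with rfl | hp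
    · simp
    have hn := norm_pos_iff.2 hp
    have hmem : ‖p‖⁻¹ • p ∈ Metric.sphere (0 : EuclideanSpace ℝ (Fin n)) 1 := by
      rw [mem_sphere_zero_iff_norm, norm_smul, norm_inv, norm_norm, inv_mul_cancel₀ hn.ne']
    have h1 := isMinOn_iff.1 hmin _ hmem
    simp only [WithLp.ofLp_smul, Matrix.mulVec_smul, smul_dotProduct, dotProduct_smul,
      smul_eq_mul] at h1
    calc _ ≤ (‖p‖⁻¹ * (‖p‖⁻¹ * (p.ofLp ⬝ᵥ S *ᵥ p.ofLp))) * ‖p‖ ^ 2 := by gcongr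
      _ = _ := by field_simp

/-- Entrywise errors of size `M ε` perturb the quadratic form by at most `M ε (∑ |p j|)² ≤ M ε r
‖p‖²`, by Cauchy–Schwarz. The factor `r` is affordable because `ε` may depend on `r`. -/
lemma sum_sq_inner_ge {r M : ℕ} (S : Matrix (Fin r) (Fin r) ℝ) (ε m : ℝ) (hε : 0 ≤ ε)
    (z : Fin M → EuclideanSpace ℝ (Fin r)) (p : EuclideanSpace ℝ (Fin r))
    (hm : m * ‖p‖ ^ 2 ≤ p.ofLp ⬝ᵥ S *ᵥ p.ofLp)
    (hz : ∀ j k, |∑ i, z i j * z i k - M * S j k| ≤ M * ε) :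
    M * (m - ε * r) * ‖p‖ ^ 2 ≤ ∑ i, (inner ℝ (z i) p) ^ 2 := by
  have h1 : ∑ i, (inner ℝ (z i) p) ^ 2 = M * (p.ofLp ⬝ᵥ S *ᵥ p.ofLp)
      + ∑ j, ∑ k, p j * p k * (∑ i, z i j * z i k - M * S j k) := by
    have e1 : ∀ i, (inner ℝ (z i) p) ^ 2 = ∑ j, ∑ k, p j * p k * (z i j * z i k) := by
      intro i
      simp only [PiLp.inner_apply, RCLike.inner_apply, conj_trivial, pow_two, Finset.sum_mul_sum]
      exact Finset.sum_congr rfl fun j _ => Finset.sum_congr rfl fun k _ => by ring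
    have e2 : M * (p.ofLp ⬝ᵥ S *ᵥ p.ofLp) = ∑ j, ∑ k, p j * p k * (M * S j k) := by
      simp only [dotProduct, Matrix.mulVec, Finset.mul_sum]
      exact Finset.sum_congr rfl fun j _ => Finset.sum_congr rfl fun k _ => by ring
    rw [e2]
    simp only [e1, mul_sub, Finset.sum_sub_distrib, add_sub_cancel]
    rw [Finset.sum_comm]
    refine Finset.sum_congr rfl fun j _ => ?_
    rw [Finset.sum_comm]
    exact Finset.sum_congr rfl fun k _ => by rw [Finset.mul_sum]
  have h2 : |∑ j, ∑ k, p j * p k * (∑ i, z i j * z i k - M * S j k)|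
      ≤ M * ε * (r * ‖p‖ ^ 2) := by
    calc _ ≤ ∑ j, ∑ k, |p j| * |p k| * (M * ε) := by
          refine (Finset.abs_sum_le_sum_abs _ _).trans (Finset.sum_le_sum fun j _ => ?_)
          refine (Finset.abs_sum_le_sum_abs _ _).trans (Finset.sum_le_sum fun k _ => ?_)
          rw [abs_mul, abs_mul]
          exact mul_le_mul_of_nonneg_left (hz j k) (by positivity)
      _ = M * ε * (∑ j, |p j|) ^ 2 := by
          rw [pow_two, Finset.sum_mul_sum, Finset.mul_sum]
          exact Finset.sum_congr rfl fun j _ => by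
            rw [Finset.mul_sum]; exact Finset.sum_congr rfl fun k _ => by ring
      _ ≤ _ := by
          gcongr
          have := sq_sum_le_card_mul_sum_sq (s := Finset.univ) (f := fun j => |p j|)
          simpa [EuclideanSpace.real_norm_sq_eq] using this
  have h3 := (abs_le.1 h2).1
  have h4 : (M : ℝ) * (m * ‖p‖ ^ 2) ≤ M * (p.ofLp ⬝ᵥ S *ᵥ p.ofLp) := by gcongr
  rw [h1]
  nlinarith

/-! ### Independence of concept and nuisance coordinates -/

/-- The characteristic function at `(t₁, t₂)` is that of `N(0, S)` at `U t₁ + V t₂`; the cross terms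
of its quadratic exponent vanish, so it factors. -/
lemma map_conceptCoord_prod {d r s : ℕ} {U : Matrix (Fin d) (Fin r) ℝ}
    {V : Matrix (Fin d) (Fin s) ℝ} {S : Matrix (Fin d) (Fin d) ℝ} (hS : S.PosSemidef)
    (hUV : Uᵀ * S * V = 0) :
    (multivariateGaussian 0 S).map (fun x => (conceptCoord U x, conceptCoord V x))
      = (multivariateGaussian 0 (Uᵀ * S * U)).prod (multivariateGaussian 0 (Vᵀ * S * V)) := by
  have hmU : Measurable (conceptCoord U) := (coordCLM U).continuous.measurable
  have hmV : Measurable (conceptCoord V) := (coordCLM V).continuous.measurable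
  have hVU : Vᵀ * S * U = 0 := by
    have hSt : Sᵀ = S := by simpa using hS.isHermitian.eq
    have := congrArg Matrix.transpose hUV
    simpa [Matrix.transpose_mul, hSt, Matrix.mul_assoc] using this
  have hsU : (Uᵀ * S * U).PosSemidef := by simpa using hS.conjTranspose_mul_mul_same U
  have hsV : (Vᵀ * S * V).PosSemidef := by simpa using hS.conjTranspose_mul_mul_same V
  have hquad : ∀ {a b : ℕ} (A : Matrix (Fin d) (Fin a) ℝ) (B : Matrix (Fin d) (Fin b) ℝ)
      (x : Fin a → ℝ) (y : Fin b → ℝ), (A *ᵥ x) ⬝ᵥ S *ᵥ (B *ᵥ y) = x ⬝ᵥ (Aᵀ * S * B) *ᵥ y := by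
    intro a b A B x y
    rw [Matrix.mul_assoc, ← Matrix.mulVec_mulVec, ← Matrix.mulVec_mulVec,
      Matrix.dotProduct_mulVec x, Matrix.vecMul_transpose]
  have : IsProbabilityMeasure ((multivariateGaussian 0 S).map
      (fun x => (conceptCoord U x, conceptCoord V x))) :=
    Measure.isProbabilityMeasure_map (by fun_prop)
  refine charFun_eq_prod_iff.1 fun t => ?_
  have h1 : charFun (((multivariateGaussian 0 S).map
      (fun x => (conceptCoord U x, conceptCoord V x))).map (WithLp.toLp 2)) t
      = charFun (multivariateGaussian 0 S) (taskParam U t.ofLp.1 + taskParam V t.ofLp.2) := by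
    rw [Measure.map_map (by fun_prop) (by fun_prop), charFun_apply, charFun_apply,
      integral_map (by fun_prop) (by fun_prop)]
    refine integral_congr_ae (ae_of_all _ fun x => ?_)
    simp only [Function.comp_apply, WithLp.prod_inner_apply, inner_add_right, inner_conceptCoord]
  rw [h1, charFun_multivariateGaussian hS, charFun_multivariateGaussian hsU,
    charFun_multivariateGaussian hsV, ← Complex.exp_add]
  congr 1
  simp only [taskParam, WithLp.ofLp_add, Matrix.mulVec_add, add_dotProduct, dotProduct_add, hquad,
    hUV, hVU, Matrix.zero_mulVec, dotProduct_zero, inner_zero_right]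
  push_cast
  ring

/-- The coordinates of the task and of the demonstration inputs are jointly independent, if the
concept and nuisance blocks are uncorrelated. -/
lemma measurePreserving_dataLaw {d r s M : ℕ} {U : Matrix (Fin d) (Fin r) ℝ}
    {V : Matrix (Fin d) (Fin s) ℝ} {S : Matrix (Fin d) (Fin d) ℝ} (hS : S.PosSemidef)
    (hUV : Uᵀ * S * V = 0) :
    MeasurePreserving (fun ω : EuclideanSpace ℝ (Fin r) ×
        (Fin M → EuclideanSpace ℝ (Fin d)) × EuclideanSpace ℝ (Fin d) =>
        (ω.1, ((fun i => conceptCoord U (ω.2.1 i)), (fun i => conceptCoord V (ω.2.1 i)))))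
      (dataLaw r M S)
      ((stdGaussian (EuclideanSpace ℝ (Fin r))).prod
        ((Measure.pi fun _ : Fin M => multivariateGaussian 0 (Uᵀ * S * U)).prod
          (Measure.pi fun _ : Fin M => multivariateGaussian 0 (Vᵀ * S * V)))) := by
  have hmU : Measurable (conceptCoord U) := (coordCLM U).continuous.measurable
  have hmV : Measurable (conceptCoord V) := (coordCLM V).continuous.measurable
  have h1 : MeasurePreserving
      (fun X : Fin M → EuclideanSpace ℝ (Fin d) => fun i =>
        (conceptCoord U (X i), conceptCoord V (X i)))
      (Measure.pi fun _ : Fin M => multivariateGaussian 0 S)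
      (Measure.pi fun _ : Fin M => (multivariateGaussian 0 (Uᵀ * S * U)).prod
        (multivariateGaussian 0 (Vᵀ * S * V))) :=
    measurePreserving_pi _ _ fun _ => ⟨by fun_prop, map_conceptCoord_prod hS hUV⟩
  have h2 := measurePreserving_arrowProdEquivProdArrow _ _ _
    (fun _ : Fin M => multivariateGaussian 0 (Uᵀ * S * U))
    (fun _ : Fin M => multivariateGaussian 0 (Vᵀ * S * V))
  exact (MeasurePreserving.id _).prod ((h2.comp h1).comp measurePreserving_fst)

/-! ### The good event and its consequence -/

lemma stdGaussian_norm_sq_tail (r : ℕ) (t : ℝ) (ht : 0 ≤ t) :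
    stdGaussian (EuclideanSpace ℝ (Fin r)) {β | 2 * (r : ℝ) + 4 * t < ‖β‖ ^ 2}
      ≤ ENNReal.ofReal (Real.exp (-t)) := by
  have h := multivariateGaussian_norm_sq_tail (1 : Matrix (Fin r) (Fin r) ℝ)
    Matrix.PosSemidef.one t
  rw [multivariateGaussian_zero_one] at h
  refine (measure_mono fun β hβ => ?_).trans h
  rw [Set.mem_ofPred_eq] at hβ ⊢
  have h1 : ‖Matrix.toEuclideanCLM (n := Fin r) (𝕜 := ℝ) 1‖ ≤ 1 := by
    rw [map_one]
    exact ContinuousLinearMap.norm_id_le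
  have h2 : 4 * ‖Matrix.toEuclideanCLM (n := Fin r) (𝕜 := ℝ) 1‖ * t ≤ 4 * 1 * t := by gcongr
  rw [Matrix.trace_one, Fintype.card_fin]
  linarith

/-- The event that one of the three concentration bounds behind nuisance stability fails. -/
lemma prod_bad_event_le {r s M : ℕ} (S : Matrix (Fin r) (Fin r) ℝ) (T : Matrix (Fin s) (Fin s) ℝ)
    (hT : T.PosSemidef) (l ε t : ℝ) (ht : 0 ≤ t)
    (htail : (Measure.pi fun _ : Fin M => multivariateGaussian 0 S)
      {z | ∃ j k, M * ε < |∑ i, z i j * z i k - M * S j k|} ≤ ENNReal.ofReal (Real.exp (-t))) :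
    ((stdGaussian (EuclideanSpace ℝ (Fin r))).prod
        ((Measure.pi fun _ : Fin M => multivariateGaussian 0 S).prod
          (Measure.pi fun _ : Fin M => multivariateGaussian 0 T)))
      ({ω | ‖ω.1‖ ^ 2 ≤ 2 * (r : ℝ) + 4 * t ∧
        (∀ j k, |∑ i, ω.2.1 i j * ω.2.1 i k - M * S j k| ≤ M * ε) ∧
        ‖∑ i, inner ℝ (ω.2.1 i) (dualRidge l ω.2.1 ω.1) • ω.2.2 i‖ ^ 2
          ≤ (∑ i, inner ℝ (ω.2.1 i) (dualRidge l ω.2.1 ω.1) ^ 2) *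
        (2 * T.trace + 4 * ‖Matrix.toEuclideanCLM (n := Fin s) (𝕜 := ℝ) T‖ * t)}ᶜ)
      ≤ 3 * ENNReal.ofReal (Real.exp (-t)) := by
  set μ := stdGaussian (EuclideanSpace ℝ (Fin r))
  set P := Measure.pi fun _ : Fin M => multivariateGaussian 0 S
  set Q := Measure.pi fun _ : Fin M => multivariateGaussian 0 T
  set N := 2 * T.trace + 4 * ‖Matrix.toEuclideanCLM (n := Fin s) (𝕜 := ℝ) T‖ * t
  set B₁ : Set (EuclideanSpace ℝ (Fin r)) := {β | 2 * (r : ℝ) + 4 * t < ‖β‖ ^ 2} with hB₁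
  set B₂ : Set (Fin M → EuclideanSpace ℝ (Fin r)) :=
    {z | ∃ j k, M * ε < |∑ i, z i j * z i k - M * S j k|} with hB₂
  set B₃ : Set ((EuclideanSpace ℝ (Fin r) × (Fin M → EuclideanSpace ℝ (Fin r))) ×
      (Fin M → EuclideanSpace ℝ (Fin s))) :=
    {ω | (∑ i, inner ℝ (ω.1.2 i) (dualRidge l ω.1.2 ω.1.1) ^ 2) * N
      < ‖∑ i, inner ℝ (ω.1.2 i) (dualRidge l ω.1.2 ω.1.1) • ω.2 i‖ ^ 2} with hB₃
  have hdual : Measurable fun ω : (EuclideanSpace ℝ (Fin r) × (Fin M → EuclideanSpace ℝ (Fin r))) ×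
      (Fin M → EuclideanSpace ℝ (Fin s)) => dualRidge l ω.1.2 ω.1.1 :=
    (measurable_dualRidge l).comp measurable_fst
  have hB₃m : MeasurableSet B₃ := by
    refine measurableSet_lt ?_ ?_ <;> fun_prop
  have hB₁le : (μ.prod (P.prod Q)) (Prod.fst ⁻¹' B₁) ≤ ENNReal.ofReal (Real.exp (-t)) := by
    have hm : MeasurableSet B₁ := measurableSet_lt measurable_const (by fun_prop)
    rw [measurePreserving_fst.measure_preimage hm.nullMeasurableSet]
    exact stdGaussian_norm_sq_tail r t ht
  have hB₂le : (μ.prod (P.prod Q)) ((fun ω => ω.2.1) ⁻¹' B₂) ≤ ENNReal.ofReal (Real.exp (-t)) := by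
    have hm : MeasurableSet B₂ := by
      simp only [hB₂, Set.ofPred_exists]
      exact MeasurableSet.iUnion fun j => MeasurableSet.iUnion fun k =>
        measurableSet_lt measurable_const (by fun_prop)
    have hmp : MeasurePreserving
        (fun ω : EuclideanSpace ℝ (Fin r) × (Fin M → EuclideanSpace ℝ (Fin r)) ×
          (Fin M → EuclideanSpace ℝ (Fin s)) => ω.2.1) (μ.prod (P.prod Q)) P :=
      measurePreserving_fst.comp measurePreserving_snd
    rw [hmp.measure_preimage hm.nullMeasurableSet]
    exact htail
  have hB₃le : (μ.prod (P.prod Q)) (MeasurableEquiv.prodAssoc.symm ⁻¹' B₃)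
      ≤ ENNReal.ofReal (Real.exp (-t)) := by
    -- Reassociating as `((β, z), u)` lets Fubini freeze `β` and `z`. The weights `⟪z i, p⟫` are
    -- then constants, and the tail bound for fixed weights applies uniformly.
    have hmp := (measurePreserving_prodAssoc μ P Q).symm
    rw [hmp.measure_preimage hB₃m.nullMeasurableSet, Measure.prod_apply hB₃m]
    calc _ ≤ ∫⁻ _, ENNReal.ofReal (Real.exp (-t)) ∂(μ.prod P) := by
          refine lintegral_mono fun ω => ?_
          exact pi_multivariateGaussian_weighted_tail T hT
            (fun i => inner ℝ (ω.2 i) (dualRidge l ω.2 ω.1)) t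
      _ = _ := by simp
  have hsub : {ω : EuclideanSpace ℝ (Fin r) × (Fin M → EuclideanSpace ℝ (Fin r)) ×
          (Fin M → EuclideanSpace ℝ (Fin s)) | ‖ω.1‖ ^ 2 ≤ 2 * (r : ℝ) + 4 * t ∧
        (∀ j k, |∑ i, ω.2.1 i j * ω.2.1 i k - M * S j k| ≤ M * ε) ∧
        ‖∑ i, inner ℝ (ω.2.1 i) (dualRidge l ω.2.1 ω.1) • ω.2.2 i‖ ^ 2
          ≤ (∑ i, inner ℝ (ω.2.1 i) (dualRidge l ω.2.1 ω.1) ^ 2) * N}ᶜ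
      ⊆ (Prod.fst ⁻¹' B₁) ∪ ((fun ω => ω.2.1) ⁻¹' B₂) ∪
        (MeasurableEquiv.prodAssoc.symm ⁻¹' B₃) := by
    intro ω hω
    by_contra hcon
    simp only [Set.mem_union, not_or] at hcon
    obtain ⟨⟨hc1, hc2⟩, hc3⟩ := hcon
    refine hω ⟨not_lt.1 hc1, fun j k => ?_, not_lt.1 hc3⟩
    by_contra hjk
    exact hc2 ⟨j, k, not_le.1 hjk⟩
  calc _ ≤ _ := measure_mono hsub
    _ ≤ _ := measure_union_le _ _
    _ ≤ _ := add_le_add (measure_union_le _ _) le_rfl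
    _ ≤ _ := add_le_add (add_le_add hB₁le hB₂le) hB₃le
    _ = _ := by ring

lemma norm_nuisance_sum_le {r s M : ℕ} (hM : 0 < M) (S : Matrix (Fin r) (Fin r) ℝ)
    (T : Matrix (Fin s) (Fin s) ℝ) (hT : T.PosSemidef) (l m a δ : ℝ) (hr : 1 ≤ r) (hl : 0 < l)
    (hm : 0 < m) (ht : 0 ≤ Real.log (a / δ))
    (hS : ∀ p : EuclideanSpace ℝ (Fin r), m * ‖p‖ ^ 2 ≤ p.ofLp ⬝ᵥ S *ᵥ p.ofLp)
    (β : EuclideanSpace ℝ (Fin r)) (z : Fin M → EuclideanSpace ℝ (Fin r))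
    (u : Fin M → EuclideanSpace ℝ (Fin s))
    (h₁ : ‖β‖ ^ 2 ≤ 2 * (r : ℝ) + 4 * Real.log (a / δ))
    (h₂ : ∀ j k, |∑ i, z i j * z i k - M * S j k| ≤ M * (m / (2 * r)))
    (h₃ : ‖∑ i, inner ℝ (z i) (dualRidge l z β) • u i‖ ^ 2
      ≤ (∑ i, inner ℝ (z i) (dualRidge l z β) ^ 2) * (2 * T.trace
        + 4 * ‖Matrix.toEuclideanCLM (n := Fin s) (𝕜 := ℝ) T‖ * Real.log (a / δ))) :
    ‖∑ i, inner ℝ (z i) (dualRidge l z β) • u i‖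
      ≤ Real.sqrt (32 / m) * nuisanceRadius a T δ
        * Real.sqrt (((r : ℝ) + Real.log (a / δ)) / (M : ℝ)) := by
  set t := Real.log (a / δ)
  set N := ‖Matrix.toEuclideanCLM (n := Fin s) (𝕜 := ℝ) T‖ with hN
  have hr' : (0 : ℝ) < r := by exact_mod_cast hr
  have hM' : (0 : ℝ) < M := by exact_mod_cast hM
  have hN0 : 0 ≤ N := norm_nonneg _
  have htr : 0 ≤ T.trace := hT.trace_nonneg
  have hc : ∑ i, inner ℝ (z i) (dualRidge l z β) ^ 2 ≤ ‖β‖ ^ 2 / (M * (m - m / (2 * r) * r)) := by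
    have e : m - m / (2 * r) * r = m / 2 := by field_simp; ring
    refine sum_sq_inner_le_of_coercive z β _ l _ hl.le (by rw [e]; positivity) ?_
      (dualRidge_spec l hl z β)
    exact sum_sq_inner_ge S _ m (by positivity) z _ (hS _) h₂
  have e : (M : ℝ) * (m - m / (2 * r) * r) = M * m / 2 := by field_simp; ring
  rw [e] at hc
  have hR : T.trace + N * t ≤ nuisanceRadius a T δ ^ 2 := by
    rw [nuisanceRadius, add_sq, Real.sq_sqrt htr, Real.sq_sqrt (by positivity)]
    have : 0 ≤ 2 * Real.sqrt T.trace * Real.sqrt (N * t) := by positivity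
    linarith
  have hR0 : 0 ≤ nuisanceRadius a T δ := by unfold nuisanceRadius; positivity
  refine le_of_sq_le_sq ?_ (by positivity)
  rw [mul_pow, mul_pow, Real.sq_sqrt (by positivity), Real.sq_sqrt (by positivity)]
  calc _ ≤ _ := h₃
    -- Here `‖β‖² ≤ 2r + 4t ≤ 4(r + t)`, the coercivity constant is `M m / 2`, and `2 tr + 4 N t ≤ 4
    -- R²`; together they give the constant `32 / m`.
    _ ≤ ((4 * (r + t)) / (M * m / 2)) * (4 * nuisanceRadius a T δ ^ 2) := by
      have hN1 : 0 ≤ N * t := by positivity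
      refine mul_le_mul (hc.trans ?_) (by linarith) (by positivity) (by positivity)
      gcongr
      linarith
    _ = _ := by field_simp; ring

lemma ofReal_one_sub_le_measure {Ω : Type*} [MeasurableSpace Ω] {μ : Measure Ω}
    [IsProbabilityMeasure μ] {s : Set Ω} {δ : ℝ} (hδ : 0 ≤ δ) (h : μ sᶜ ≤ ENNReal.ofReal δ) :
    ENNReal.ofReal (1 - δ) ≤ μ s := by
  rw [ENNReal.ofReal_sub _ hδ, ENNReal.ofReal_one, tsub_le_iff_right]
  calc (1 : ENNReal) = μ Set.univ := measure_univ.symm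
    _ ≤ μ s + μ sᶜ := measure_univ_le_add_compl s
    _ ≤ _ := by gcongr

end ConceptICL

/-! ### The main theorem -/

theorem mainTheorem5 :
    (∃ a₀ : ℝ, 1 ≤ a₀ ∧
      ∀ (r : ℕ) (_ : 1 ≤ r) (Λ11 : Matrix (Fin r) (Fin r) ℝ) (_ : Λ11.PosDef)
        (l₀ : ℝ) (_ : 0 < l₀),
      ∃ K₀ Kstab : ℝ, 0 < K₀ ∧ 0 < Kstab ∧
        ∀ (d : ℕ) (_ : r ≤ d) (Λ : Matrix (Fin d) (Fin d) ℝ) (_ : Λ.PosDef)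
          (U : Matrix (Fin d) (Fin r) ℝ) (_ : Uᵀ * U = 1)
          (Uperp : Matrix (Fin d) (Fin (d - r)) ℝ) (_ : Uperpᵀ * Uperp = 1) (_ : Uᵀ * Uperp = 0)
          (_ : Uᵀ * Λ * U = Λ11) (_ : Uᵀ * Λ * Uperp = 0)
          (δ : ℝ) (_ : 0 < δ) (_ : δ < 1)
          (M : ℕ) (_ : K₀ * ConceptICL.logDim a₀ r δ ≤ (M : ℝ)),
        ENNReal.ofReal (1 - δ) ≤ ConceptICL.dataLaw r M Λ
          {ω | ∀ v ∈ (ConceptICL.colSpan U)ᗮ,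
            |ConceptICL.ridgePred (l₀ / M) ω.2.1
                  (ConceptICL.labels (ConceptICL.taskParam U ω.1) ω.2.1) (ω.2.2 + v)
                - ConceptICL.ridgePred (l₀ / M) ω.2.1
                  (ConceptICL.labels (ConceptICL.taskParam U ω.1) ω.2.1) ω.2.2|
              ≤ Kstab * ConceptICL.nuisanceRadius a₀ (Uperpᵀ * Λ * Uperp) δ * ‖v‖
                * Real.sqrt (((r : ℝ) + Real.log (a₀ / δ)) / (M : ℝ))}) ∧
    (∀ (r d : ℕ) (_ : 1 ≤ r) (_ : r ≤ d) (U : Matrix (Fin d) (Fin r) ℝ) (_ : Uᵀ * U = 1)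
        (σ : ℝ) (_ : 0 < σ) (M : ℕ) (X : Fin M → EuclideanSpace ℝ (Fin d)) (y : Fin M → ℝ)
        (x v : EuclideanSpace ℝ (Fin d)) (_ : v ∈ (ConceptICL.colSpan U)ᗮ),
      ConceptICL.bayesPred U σ X y (x + v) = ConceptICL.bayesPred U σ X y x) := by
  open ConceptICL in
  refine ⟨⟨3, by norm_num, ?_⟩, fun r d _ _ U _ σ _ M X y x v hv =>
    bayesPred_add_orthogonal σ X y x v hv⟩
  intro r hr S hS l₀ hl
  obtain ⟨m, hm, hSm⟩ := exists_coercive_of_posDef S hS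
  have hr' : (1 : ℝ) ≤ r := by exact_mod_cast hr
  -- With `ε = m / (2r)` the entrywise error costs half of the coercivity `m`.
  obtain ⟨c, hc, htail⟩ := exists_pi_second_moment_tail S hS.posSemidef
    (ε := m / (2 * r)) (by positivity)
  -- This `K₀` makes `c M ≥ t + 2r²`, and `exp (2r²)` absorbs the union-bound prefactor `2r²`. Both
  -- constants depend only on `Λ11` (which fixes `r`, `m` and `c`).
  refine ⟨(1 + 2 * r ^ 2) / c, Real.sqrt (32 / m), by positivity, by positivity, ?_⟩
  intro d hrd Λ hΛ U hU V hV hUV hUU hΛUV δ hδ hδ1 M hKM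
  set t := Real.log (3 / δ)
  have ht : 0 ≤ t := Real.log_nonneg (by rw [le_div_iff₀ hδ]; linarith)
  have hexp : Real.exp (-t) = δ / 3 := by
    rw [Real.exp_neg, Real.exp_log (by positivity), inv_div]
  have hM' : (0 : ℝ) < M := lt_of_lt_of_le (by unfold logDim; positivity) hKM
  have hM : 0 < M := by exact_mod_cast hM'
  have htailM : ENNReal.ofReal (2 * r ^ 2 * Real.exp (-(c * M)))
      ≤ ENNReal.ofReal (Real.exp (-t)) := by
    apply ENNReal.ofReal_le_ofReal
    have h1 : (1 + 2 * (r : ℝ) ^ 2) * (r + t) ≤ c * M := by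
      rw [logDim, div_mul_eq_mul_div, div_le_iff₀ hc] at hKM
      linarith
    have h2 : t + 2 * (r : ℝ) ^ 2 ≤ c * M := by
      refine le_trans ?_ h1
      nlinarith [mul_nonneg (sq_nonneg (r : ℝ)) ht,
        mul_nonneg (sq_nonneg (r : ℝ)) (sub_nonneg.2 hr')]
    calc 2 * (r : ℝ) ^ 2 * Real.exp (-(c * M))
        ≤ Real.exp (2 * (r : ℝ) ^ 2) * Real.exp (-(c * M)) := by
          gcongr
          linarith [Real.add_one_le_exp (2 * (r : ℝ) ^ 2)]
      _ = Real.exp (2 * (r : ℝ) ^ 2 + -(c * M)) := (Real.exp_add _ _).symm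
      _ ≤ Real.exp (-t) := Real.exp_le_exp.2 (by linarith)
  have hT : (Vᵀ * Λ * V).PosSemidef := by
    simpa using hΛ.posSemidef.conjTranspose_mul_mul_same V
  have hbad := prod_bad_event_le (M := M) S (Vᵀ * Λ * V) hT l₀ (m / (2 * r)) t ht
    ((htail M).trans htailM)
  have hmp := measurePreserving_dataLaw (M := M) hΛ.posSemidef hΛUV
  rw [hUU] at hmp
  set G := {ω : EuclideanSpace ℝ (Fin r) × (Fin M → EuclideanSpace ℝ (Fin r)) ×
          (Fin M → EuclideanSpace ℝ (Fin (d - r))) | ‖ω.1‖ ^ 2 ≤ 2 * (r : ℝ) + 4 * t ∧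
        (∀ j k, |∑ i, ω.2.1 i j * ω.2.1 i k - M * S j k| ≤ M * (m / (2 * r))) ∧
        ‖∑ i, inner ℝ (ω.2.1 i) (dualRidge l₀ ω.2.1 ω.1) • ω.2.2 i‖ ^ 2
          ≤ (∑ i, inner ℝ (ω.2.1 i) (dualRidge l₀ ω.2.1 ω.1) ^ 2) *
        (2 * (Vᵀ * Λ * V).trace
          + 4 * ‖Matrix.toEuclideanCLM (n := Fin (d - r)) (𝕜 := ℝ) (Vᵀ * Λ * V)‖ * t)}
  have hprob : IsProbabilityMeasure (dataLaw r M Λ) := by unfold dataLaw; infer_instance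
  have hδ3 : 3 * ENNReal.ofReal (Real.exp (-t)) = ENNReal.ofReal δ := by
    rw [hexp, ← ENNReal.ofReal_ofNat 3, ← ENNReal.ofReal_mul (by norm_num)]
    congr 1
    ring
  -- The inequality for preimages needs no measurability of `G`.
  have hpre := (hmp.measure_preimage_le Gᶜ).trans (hbad.trans_eq hδ3)
  rw [Set.preimage_compl] at hpre
  refine (ofReal_one_sub_le_measure hδ.le hpre).trans (measure_mono ?_)
  intro ω hω v hv
  obtain ⟨h₁, h₂, h₃⟩ := hω
  refine (abs_ridgePred_sub_le hrd hU hV hUV hM l₀ hl ω.2.1 ω.1 ω.2.2 v hv).trans ?_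
  have key := norm_nuisance_sum_le hM S (Vᵀ * Λ * V) hT l₀ m 3 δ hr hl hm ht hSm
    ω.1 _ _ h₁ h₂ h₃
  calc _ ≤ _ := mul_le_mul_of_nonneg_right key (norm_nonneg v)
    _ = _ := by ring
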